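/- **Theorem (convergence of CNOT).** Let $k\ge 1$, $q\ge k$ be integers, $A\in\mathbb R^{m\times n}$, $\varphi=\frac{1+\sqrt5}{2}$ and $N=\lceil n/k\rceil$. For an integer $s$, let $\delta_s$ be the restricted isometry constant of $A$ of order $s$, i.e. the smallest $\delta\ge 0$ with $(1-\delta)\|v\|^2\le\|Av\|^2\le(1+\delta)\|v\|^2$ for all $v\in\mathbb R^n$ with at most $s$ nonzero entries ($\|\cdot\|$ is the Euclidean norm). For a vector $z$, $\mathcal H_s(z)$ keeps $s$ entries of $z$ of largest magnitude (all entries if $s\ge n$) and sets the others to $0$, and $\mathcal L_s(z)$ is an index set of at most $s$ elements such that restricting $z$ to it gives $\mathcal H_s(z)$ (for instance the support of $\mathcal H_s(z)$); ties may be broken in any way. Let $y=Ax+\eta$ with $x\in\mathbb R^n$, $\eta\in\mathbb R^m$, let $S=\mathcal L_k(x)$, let $x_S$ and $x_{\overline S}$ agree with $x$ on $S$ and on its complement, respectively, and vanish elsewhere, and put $\eta'=Ax_{\overline S}+\eta$, so that $y=Ax_S+\eta'$. *Algorithm.* A sequence $x^{(0)},x^{(1)},\dots$ is generated by CNOT with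 parameters $\lambda\in\mathbb R$, $\alpha>0$, $\gamma>0$ if $x^{(0)}=0$ and for every $p\ge 0$, with $\Omega=\mathcal L_q(A^\top(y-Ax^{(p)}))$, $$u^{(p)}=x^{(p)}+\lambda M(\Omega)Z(\Omega)A^\top(y-Ax^{(p)}),$$ $$w^{(p)}\in\arg\min_w\{\|y-A(w\otimes u^{(p)})\|^2:\ \mathbf e^\top w=k,\ \mathbf 0\le w\le\mathbf e\},\qquad x^{(p+1)}=\mathcal H_k(w^{(p)}\otimes u^{(p)}).$$ Here $\otimes$ is the entrywise product, $\mathbf e$ is the all-ones vector, $M(\Omega)$ has $\Omega\times\Omega$ block $(A_\Omega^\top A_\Omega)^{-1}$ (where $A_\Omega$ consists of the columns of $A$ indexed by $\Omega$), diagonal entries $\alpha$ outside $\Omega$ and all other entries $0$, and $Z(\Omega)$ is diagonal with entries $1$ on $\Omega$ and $\gamma$ off $\Omega$. *Claim.* The equation $$9\varphi^2\left[N\beta^5+(N+4\sqrt N)\beta^4+4(\sqrt N+1)\beta^3+4\beta^2\right]+\beta-1=0$$ has a unique root $\beta^*$ in $(0,1)$. Suppose that $\delta_{\max\{q,3k\}}<\beta^*$,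 that $$(1+\delta_q)(1-c)<\lambda<(1-\delta_q)(1+c),\qquad c=\frac{\frac1{3\varphi}\sqrt{\frac{1-\delta_{2k}}{1+\delta_k}}-\delta_{3k}}{1+\sqrt N\,\delta_{3k}},$$ and that $\frac1{1+\delta_q}\le\alpha\gamma\le\frac1{1-\delta_q}$. Put $\Delta=\max\left\{\left|1-\frac{\lambda}{1-\delta_q}\right|,\left|1-\frac{\lambda}{1+\delta_q}\right|\right\}$ and $$\rho_3=3\varphi\sqrt{\frac{1+\delta_k}{1-\delta_{2k}}}\left(\delta_{3k}+\Delta\,(1+\sqrt N\,\delta_{3k})\right),\qquad \tau_3=\frac{3\lambda\varphi(1+\delta_k)\sqrt N}{(1-\delta_q)\sqrt{1-\delta_{2k}}}+\frac{2\varphi}{\sqrt{1-\delta_{2k}}}.$$ Then $\rho_3<1$, and every sequence $\{x^{(p)}\}$ generated by CNOT satisfies $$\|x^{(p+1)}-x_S\|\le\rho_3\,\|x^{(p)}-x_S\|+\tau_3\,\|\eta'\|\qquad\text{for all }p\ge 0.$$ If moreover $\eta'=0$, then $x^{(p)}\to x_S$ as $p\to\infty$. -/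

import Mathlib

open Filter Topology

namespace CNOT

noncomputable section

/-- The product `A x`, as a map between Euclidean spaces. -/
abbrev apply {m n : ℕ} (A : Matrix (Fin m) (Fin n) ℝ) (x : EuclideanSpace ℝ (Fin n)) :
    EuclideanSpace ℝ (Fin m) :=
  Matrix.toEuclideanLin A x

/-- The `ℓ₀`-"norm": the number of nonzero entries. -/
def l0 {n : ℕ} (x : EuclideanSpace ℝ (Fin n)) : ℕ :=
  (Finset.univ.filter fun i => x i ≠ 0).card

/-- The vector `x_Ω` in `ℝⁿ`: it agrees with `x` on `Ω` and vanishes off `Ω`. -/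
def restrict {n : ℕ} (Ω : Finset (Fin n)) (x : EuclideanSpace ℝ (Fin n)) :
    EuclideanSpace ℝ (Fin n) :=
  WithLp.toLp 2 fun i => if i ∈ Ω then x i else 0

/-- The Hadamard product. -/
def hadamard {n : ℕ} (u v : EuclideanSpace ℝ (Fin n)) : EuclideanSpace ℝ (Fin n) :=
  WithLp.toLp 2 fun i => u i * v i

/-- The restricted isometry constant of order `s`: the smallest `δ ≥ 0` with
`(1 - δ)‖x‖² ≤ ‖A x‖² ≤ (1 + δ)‖x‖²` for all `s`-sparse `x`. (The set of such `δ` is nonempty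
and closed; `A` has the restricted isometry property of order `s` iff `ric A s < 1`.) -/
def ric {m n : ℕ} (A : Matrix (Fin m) (Fin n) ℝ) (s : ℕ) : ℝ :=
  sInf {δ : ℝ | 0 ≤ δ ∧ ∀ x : EuclideanSpace ℝ (Fin n), l0 x ≤ s →
    (1 - δ) * ‖x‖ ^ 2 ≤ ‖apply A x‖ ^ 2 ∧ ‖apply A x‖ ^ 2 ≤ (1 + δ) * ‖x‖ ^ 2}

/-- `h` is a value of the hard thresholding operator `H_s` at `z`: `h` keeps `s` entries of `z`
of largest magnitude (all entries, if `s ≥ n`) and is zero elsewhere. Ties between entries of equal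
magnitude may be broken in any way. -/
def IsHardThreshold {n : ℕ} (s : ℕ) (z h : EuclideanSpace ℝ (Fin n)) : Prop :=
  ∃ T : Finset (Fin n), T.card = min s n ∧ (∀ i ∈ T, ∀ j ∉ T, |z j| ≤ |z i|) ∧ h = restrict T z

/-- `Ω` is a value of `L_s` at `z`, an index set of the `s` largest entries of `z` in magnitude:
`Ω` has at most `s` elements and restricting `z` to `Ω` gives `H_s(z)`. Both the support of `H_s(z)`
and an index set of exactly `s` largest entries (which differ only when `z` has
fewer than `s` nonzero entries) are allowed. -/
def IsTopIndexSet {n : ℕ} (s : ℕ) (z : EuclideanSpace ℝ (Fin n)) (Ω : Finset (Fin n)) : Prop :=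
  Ω.card ≤ s ∧ IsHardThreshold s z (restrict Ω z)

/-- The submatrix `A_Ω` of the columns indexed by `Ω`. -/
def cols {m n : ℕ} (A : Matrix (Fin m) (Fin n) ℝ) (Ω : Finset (Fin n)) :
    Matrix (Fin m) Ω ℝ :=
  A.submatrix id Subtype.val

/-- The matrix `M(Ω)`: its `Ω × Ω` block is `(A_Ωᵀ A_Ω)⁻¹`, its diagonal entries outside `Ω` are
`α`, all other entries are zero. -/
def newtonMatrix {m n : ℕ} (A : Matrix (Fin m) (Fin n) ℝ) (α : ℝ) (Ω : Finset (Fin n)) :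
    Matrix (Fin n) (Fin n) ℝ :=
  fun i j =>
    if h : i ∈ Ω ∧ j ∈ Ω then (((cols A Ω).transpose * cols A Ω)⁻¹) ⟨i, h.1⟩ ⟨j, h.2⟩
    else if i = j then α else 0

/-- The diagonal matrix `Z(Ω)`, with entries `1` on `Ω` and `γ` off `Ω`. -/
def scaleMatrix {n : ℕ} (γ : ℝ) (Ω : Finset (Fin n)) : Matrix (Fin n) (Fin n) ℝ :=
  Matrix.diagonal fun i => if i ∈ Ω then 1 else γ

/-- The compressed Newton step `u = x + λ M(Ω) Z(Ω) Aᵀ (y - A x)`. -/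
def newtonStep {m n : ℕ} (A : Matrix (Fin m) (Fin n) ℝ) (y : EuclideanSpace ℝ (Fin m))
    (lam α γ : ℝ) (Ω : Finset (Fin n)) (x : EuclideanSpace ℝ (Fin n)) :
    EuclideanSpace ℝ (Fin n) :=
  x + lam • apply (newtonMatrix A α Ω * scaleMatrix γ Ω * A.transpose) (y - apply A x)

/-- The feasible set `{w : eᵀ w = k, 0 ≤ w ≤ e}`. -/
def relaxedWeights (n k : ℕ) : Set (EuclideanSpace ℝ (Fin n)) :=
  {w | ∑ i, w i = (k : ℝ) ∧ ∀ i, 0 ≤ w i ∧ w i ≤ 1}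

/-- `w` is a solution of `min {‖y - A (w ⊗ u)‖² : eᵀ w = k, 0 ≤ w ≤ e}`. -/
def IsOptimalWeight {m n : ℕ} (A : Matrix (Fin m) (Fin n) ℝ) (y : EuclideanSpace ℝ (Fin m))
    (k : ℕ) (u w : EuclideanSpace ℝ (Fin n)) : Prop :=
  w ∈ relaxedWeights n k ∧
    IsMinOn (fun v => ‖y - apply A (hadamard v u)‖ ^ 2) (relaxedWeights n k) w

/-- `x'` is obtained from `x` by one iteration of the CNOT algorithm. -/
def IsStep {m n : ℕ} (A : Matrix (Fin m) (Fin n) ℝ) (y : EuclideanSpace ℝ (Fin m))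
    (k q : ℕ) (lam α γ : ℝ) (x x' : EuclideanSpace ℝ (Fin n)) : Prop :=
  ∃ (Ω : Finset (Fin n)) (w : EuclideanSpace ℝ (Fin n)),
    IsTopIndexSet q (apply A.transpose (y - apply A x)) Ω ∧
    IsOptimalWeight A y k (newtonStep A y lam α γ Ω x) w ∧
    IsHardThreshold k (hadamard w (newtonStep A y lam α γ Ω x)) x'

/-- `X 0, X 1, …` is a sequence generated by the CNOT algorithm, started at the origin. -/
def IsSequence {m n : ℕ} (A : Matrix (Fin m) (Fin n) ℝ) (y : EuclideanSpace ℝ (Fin m))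
    (k q : ℕ) (lam α γ : ℝ) (X : ℕ → EuclideanSpace ℝ (Fin n)) : Prop :=
  X 0 = 0 ∧ ∀ p, IsStep A y k q lam α γ (X p) (X (p + 1))

/-- The number `⌈n / k⌉`, as a real number. -/
def blocks (n k : ℕ) : ℝ := ((⌈(n : ℝ) / (k : ℝ)⌉₊ : ℕ) : ℝ)

/-- The quintic whose root in `(0, 1)` is the bound on the restricted isometry constant. -/
def quintic (n k : ℕ) (β : ℝ) : ℝ :=
  9 * Real.goldenRatio ^ 2 *
      (blocks n k * β ^ 5 + (blocks n k + 4 * √(blocks n k)) * β ^ 4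
        + 4 * (√(blocks n k) + 1) * β ^ 3 + 4 * β ^ 2)
    + β - 1

/-- `Δ(λ, δ) = max {|1 - λ / (1 - δ)|, |1 - λ / (1 + δ)|}`. -/
def Delta (lam δ : ℝ) : ℝ := max |1 - lam / (1 - δ)| |1 - lam / (1 + δ)|

/-- The half-width parameter `(√((1 - δ₂ₖ) / (1 + δₖ)) / (3 φ) - δ₃ₖ) / (1 + √⌈n/k⌉ δ₃ₖ)`
in the admissible range of the stepsize. -/
def width {m n : ℕ} (A : Matrix (Fin m) (Fin n) ℝ) (k : ℕ) : ℝ :=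
  (1 / (3 * Real.goldenRatio) * √((1 - ric A (2 * k)) / (1 + ric A k)) - ric A (3 * k))
    / (1 + √(blocks n k) * ric A (3 * k))

/-- The contraction factor `ρ₃`. -/
def rho {m n : ℕ} (A : Matrix (Fin m) (Fin n) ℝ) (k q : ℕ) (lam : ℝ) : ℝ :=
  3 * Real.goldenRatio * √((1 + ric A k) / (1 - ric A (2 * k)))
    * (ric A (3 * k) + Delta lam (ric A q) * (1 + √(blocks n k) * ric A (3 * k)))

/-- The noise amplification factor `τ₃`. -/
def tau {m n : ℕ} (A : Matrix (Fin m) (Fin n) ℝ) (k q : ℕ) (lam : ℝ) : ℝ :=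
  3 * lam * Real.goldenRatio * (1 + ric A k) * √(blocks n k)
      / ((1 - ric A q) * √(1 - ric A (2 * k)))
    + 2 * Real.goldenRatio / √(1 - ric A (2 * k))

end

end CNOT

namespace CNOT

/-! ### Coordinate restriction, adjoints and polarization. -/

section Basics

variable {m n : ℕ}

/-! Moving the tail of `x` into the noise, one may take `x` to be `k`-sparse. With `e = x - x'` (at
most `2k` nonzeros), `h = AᵀA e`, `ν = Aᵀη` and `P = M(Ω)Z(Ω)`, the Newton step satisfies `u - x =
-(e - h) - (h - λPh) + λPν`. On a window of `k` indices, the first term is at most `δ₃ₖ‖e‖`, since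
`I - AᵀA` is small on sparse vectors. The operator `P` is symmetric with quadratic form between
`1/(1+δ_q)` and `1/(1-δ_q)`, so `I - λP` has norm at most `Δ`. Cutting the indices into `N` blocks
bounds the full norms of `h` and `ν`, which is where `√N` enters
(`norm_restrict_newtonStep_sub_le`).

The weight step keeps this windowwise error under control: a relaxed weight is a convex combination
of indicators of `k`-sets, so convexity transfers bounds from windows to weights (`hadamard_bound`),
while optimality allows comparison with the indicator of the true support. Hard thresholding costs a
factor `φ` on the joint support, where the isometry property of order `2k` passes from residuals to
errors (`norm_optimalThreshold_sub_le`). The stepsize range forces `Δ < c`, which is `ρ₃ < 1`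
rearranged; with no noise the error then decays geometrically. -/

@[simp] theorem restrict_apply (Ω : Finset (Fin n)) (x : EuclideanSpace ℝ (Fin n)) (i : Fin n) :
    restrict Ω x i = if i ∈ Ω then x i else 0 := rfl

@[simp] theorem hadamard_apply (u v : EuclideanSpace ℝ (Fin n)) (i : Fin n) :
    hadamard u v i = u i * v i := rfl

theorem restrict_add (Ω : Finset (Fin n)) (x y : EuclideanSpace ℝ (Fin n)) :
    restrict Ω (x + y) = restrict Ω x + restrict Ω y := by
  ext i; by_cases h : i ∈ Ω <;> simp [h]

theorem restrict_sub (Ω : Finset (Fin n)) (x y : EuclideanSpace ℝ (Fin n)) :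
    restrict Ω (x - y) = restrict Ω x - restrict Ω y := by
  ext i; by_cases h : i ∈ Ω <;> simp [h]

theorem restrict_smul (Ω : Finset (Fin n)) (a : ℝ) (x : EuclideanSpace ℝ (Fin n)) :
    restrict Ω (a • x) = a • restrict Ω x := by
  ext i; by_cases h : i ∈ Ω <;> simp [h]

theorem restrict_add_restrict_compl (Ω : Finset (Fin n)) (x : EuclideanSpace ℝ (Fin n)) :
    restrict Ω x + restrict Ωᶜ x = x := by
  ext i; by_cases h : i ∈ Ω <;> simp [h]

theorem restrict_restrict_of_subset {S T : Finset (Fin n)} (h : S ⊆ T)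
    (x : EuclideanSpace ℝ (Fin n)) : restrict T (restrict S x) = restrict S x := by
  ext i
  by_cases hS : i ∈ S
  · simp [hS, h hS]
  · simp [hS]

theorem restrict_restrict (S : Finset (Fin n)) (x : EuclideanSpace ℝ (Fin n)) :
    restrict S (restrict S x) = restrict S x :=
  restrict_restrict_of_subset subset_rfl x

theorem restrict_eq_self_of_subset {S T : Finset (Fin n)} (h : S ⊆ T)
    {x : EuclideanSpace ℝ (Fin n)} (hx : restrict S x = x) : restrict T x = x := by
  rw [← hx, restrict_restrict_of_subset h]

theorem inner_eq_sum (x y : EuclideanSpace ℝ (Fin n)) : inner ℝ x y = ∑ i, x i * y i := by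
  simp [PiLp.inner_apply, mul_comm]

theorem inner_restrict_left (Ω : Finset (Fin n)) (x y : EuclideanSpace ℝ (Fin n)) :
    inner ℝ (restrict Ω x) y = inner ℝ (restrict Ω x) (restrict Ω y) := by
  simp only [inner_eq_sum, restrict_apply]
  refine Finset.sum_congr rfl fun i _ => ?_
  by_cases h : i ∈ Ω <;> simp [h]

theorem norm_restrict_sq (Ω : Finset (Fin n)) (x : EuclideanSpace ℝ (Fin n)) :
    ‖restrict Ω x‖ ^ 2 = ∑ i ∈ Ω, x i ^ 2 := by
  simp [EuclideanSpace.real_norm_sq_eq, ite_pow]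

theorem norm_restrict_le (Ω : Finset (Fin n)) (x : EuclideanSpace ℝ (Fin n)) :
    ‖restrict Ω x‖ ≤ ‖x‖ := by
  refine (abs_le_of_sq_le_sq' ?_ (norm_nonneg _)).2
  rw [norm_restrict_sq, EuclideanSpace.real_norm_sq_eq]
  exact Finset.sum_le_univ_sum_of_nonneg fun i => sq_nonneg _

theorem norm_sq_eq_restrict_add_compl (Ω : Finset (Fin n)) (x : EuclideanSpace ℝ (Fin n)) :
    ‖x‖ ^ 2 = ‖restrict Ω x‖ ^ 2 + ‖restrict Ωᶜ x‖ ^ 2 := by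
  rw [norm_restrict_sq, norm_restrict_sq, EuclideanSpace.real_norm_sq_eq,
    Finset.sum_add_sum_compl]

theorem l0_le_card {U : Finset (Fin n)} {x : EuclideanSpace ℝ (Fin n)} (hx : restrict U x = x) :
    l0 x ≤ U.card := by
  refine Finset.card_le_card fun i hi => ?_
  by_contra h
  refine (Finset.mem_filter.1 hi).2 ?_
  rw [← hx]; simp [h]

theorem inner_apply_transpose (A : Matrix (Fin m) (Fin n) ℝ) (v : EuclideanSpace ℝ (Fin m))
    (x : EuclideanSpace ℝ (Fin n)) :
    inner ℝ (apply A.transpose v) x = inner ℝ v (apply A x) := by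
  have h := Matrix.toEuclideanLin_conjTranspose_eq_adjoint A
  rw [Matrix.conjTranspose_eq_transpose_of_trivial] at h
  rw [apply, h, LinearMap.adjoint_inner_left]

theorem apply_mul {l : ℕ} (A : Matrix (Fin l) (Fin m) ℝ) (B : Matrix (Fin m) (Fin n) ℝ)
    (x : EuclideanSpace ℝ (Fin n)) : apply (A * B) x = apply A (apply B x) := by
  simp only [apply, Matrix.toEuclideanLin, Matrix.toLpLin_mul 2 2 2, LinearMap.comp_apply]

theorem apply_coord (A : Matrix (Fin m) (Fin n) ℝ) (x : EuclideanSpace ℝ (Fin n)) (i : Fin m) :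
    apply A x i = ∑ j, A i j * x j := rfl

/-- A symmetric operator whose quadratic form is bounded by `δ` on the span of `e` and `v`
has its bilinear form bounded by `δ` at `(e, v)`. -/
theorem abs_inner_le_of_quadratic {E : Type*} [NormedAddCommGroup E] [InnerProductSpace ℝ E]
    {T : E →ₗ[ℝ] E} (hT : T.IsSymmetric) {δ : ℝ} {e v : E}
    (h : ∀ a b : ℝ, |inner ℝ (T (a • e + b • v)) (a • e + b • v)| ≤ δ * ‖a • e + b • v‖ ^ 2) :
    |inner ℝ (T e) v| ≤ δ * ‖e‖ * ‖v‖ := by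
  by_cases he : e = 0
  · simp [he]
  by_cases hv : v = 0
  · simp [hv]
  have he' : 0 < ‖e‖ := norm_pos_iff.2 he
  have hv' : 0 < ‖v‖ := norm_pos_iff.2 hv
  have hs : inner ℝ (T v) e = inner ℝ (T e) v := by rw [hT v e, real_inner_comm]
  -- Polarization at `‖v‖e ± ‖e‖v`: the quadratic forms differ by `4‖e‖‖v‖⟨Te, v⟩`, and the squared
  -- norms add up to `4‖e‖²‖v‖²`.
  have h1 := h ‖v‖ ‖e‖
  have h2 := h ‖v‖ (-‖e‖)
  rw [← real_inner_self_eq_norm_sq] at h1 h2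
  simp only [map_add, map_smul, inner_add_left, inner_add_right, real_inner_smul_left,
    real_inner_smul_right, hs, real_inner_self_eq_norm_sq, real_inner_comm e v, norm_smul, norm_neg, norm_norm, mul_pow] at h1 h2
  rw [abs_le] at h1 h2
  have hp : 0 < 4 * (‖e‖ * ‖v‖) := by positivity
  rw [abs_le]
  constructor
  · refine le_of_mul_le_mul_left ?_ hp
    linarith [h1.1, h2.2]
  · refine le_of_mul_le_mul_left ?_ hp
    linarith [h1.2, h2.1]

end Basics

/-! ### Restricted isometry constants and the Gram operator. -/

section RestrictedIsometry

variable {m n : ℕ} (A : Matrix (Fin m) (Fin n) ℝ)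

/-- The value `1 + ‖A‖²` is always admissible, so the infimum is a genuine one rather than the
default for an empty set. -/
theorem ric_set_nonempty (s : ℕ) :
    {δ : ℝ | 0 ≤ δ ∧ ∀ x : EuclideanSpace ℝ (Fin n), l0 x ≤ s →
      (1 - δ) * ‖x‖ ^ 2 ≤ ‖apply A x‖ ^ 2 ∧ ‖apply A x‖ ^ 2 ≤ (1 + δ) * ‖x‖ ^ 2}.Nonempty := by
  have hc (x) : ‖apply A x‖ ≤ ‖(Matrix.toEuclideanLin A).toContinuousLinearMap‖ * ‖x‖ :=
    (Matrix.toEuclideanLin A).toContinuousLinearMap.le_opNorm x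
  set c := ‖(Matrix.toEuclideanLin A).toContinuousLinearMap‖
  refine ⟨1 + c ^ 2, by positivity, fun x _ => ⟨?_, ?_⟩⟩
  · nlinarith [sq_nonneg ‖apply A x‖, sq_nonneg (c * ‖x‖)]
  · have h1 := pow_le_pow_left₀ (norm_nonneg _) (hc x) 2
    nlinarith [sq_nonneg ‖x‖]

theorem ric_nonneg (s : ℕ) : 0 ≤ ric A s := Real.sInf_nonneg fun _ h => h.1

theorem ric_mono : Monotone (ric A) := fun _ t hst =>
  csInf_le_csInf ⟨0, fun _ h => h.1⟩ (ric_set_nonempty A t)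
    fun _ h => ⟨h.1, fun x hx => h.2 x (hx.trans hst)⟩

variable {A}

/-- The infimum is attained: each nonzero sparse vector gives a lower bound valid for every
admissible `δ`, hence for the infimum. The same argument gives the upper estimate below. -/
theorem le_norm_apply_sq {s : ℕ} {U : Finset (Fin n)} (hU : U.card ≤ s)
    {x : EuclideanSpace ℝ (Fin n)} (hx : restrict U x = x) :
    (1 - ric A s) * ‖x‖ ^ 2 ≤ ‖apply A x‖ ^ 2 := by
  have hl := (l0_le_card hx).trans hU
  rcases (sq_nonneg ‖x‖).eq_or_lt with h0 | h0
  · rw [← h0, mul_zero]; positivity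
  have : 1 - ‖apply A x‖ ^ 2 / ‖x‖ ^ 2 ≤ ric A s := by
    refine le_csInf (ric_set_nonempty A s) fun δ h => ?_
    have := (h.2 x hl).1
    rw [← le_div_iff₀ h0] at this
    linarith
  rw [← le_div_iff₀ h0]
  linarith

theorem norm_apply_sq_le {s : ℕ} {U : Finset (Fin n)} (hU : U.card ≤ s)
    {x : EuclideanSpace ℝ (Fin n)} (hx : restrict U x = x) :
    ‖apply A x‖ ^ 2 ≤ (1 + ric A s) * ‖x‖ ^ 2 := by
  have hl := (l0_le_card hx).trans hU
  rcases (sq_nonneg ‖x‖).eq_or_lt with h0 | h0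
  · have : x = 0 := by simpa using h0.symm
    simp [this]
  have : ‖apply A x‖ ^ 2 / ‖x‖ ^ 2 - 1 ≤ ric A s := by
    refine le_csInf (ric_set_nonempty A s) fun δ h => ?_
    have := (h.2 x hl).2
    rw [← div_le_iff₀ h0] at this
    linarith
  rw [← div_le_iff₀ h0]
  linarith

theorem norm_apply_le {s : ℕ} {U : Finset (Fin n)} (hU : U.card ≤ s)
    {x : EuclideanSpace ℝ (Fin n)} (hx : restrict U x = x) :
    ‖apply A x‖ ≤ √(1 + ric A s) * ‖x‖ := by
  have := ric_nonneg A s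
  refine (abs_le_of_sq_le_sq' ?_ (by positivity)).2
  rw [mul_pow, Real.sq_sqrt (by linarith)]
  exact norm_apply_sq_le hU hx

theorem sqrt_mul_norm_le_norm_apply {s : ℕ} {U : Finset (Fin n)} (hU : U.card ≤ s)
    (hs : ric A s ≤ 1) {x : EuclideanSpace ℝ (Fin n)} (hx : restrict U x = x) :
    √(1 - ric A s) * ‖x‖ ≤ ‖apply A x‖ := by
  refine (abs_le_of_sq_le_sq' ?_ (by positivity)).2
  rw [mul_pow, Real.sq_sqrt (by linarith)]
  exact le_norm_apply_sq hU hx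

theorem isSymmetric_sub_gram :
    (LinearMap.id - Matrix.toEuclideanLin A.transpose ∘ₗ Matrix.toEuclideanLin A).IsSymmetric := by
  intro x y
  simp only [LinearMap.sub_apply, LinearMap.id_apply, LinearMap.comp_apply, inner_sub_left,
    inner_sub_right]
  rw [inner_apply_transpose, real_inner_comm (apply A.transpose _) x, inner_apply_transpose,
    real_inner_comm (apply A x)]

/-- Near-isometry of the Gram operator, tested against a sparse window. -/
theorem norm_restrict_sub_gram_le {s : ℕ} {U K : Finset (Fin n)} (hUK : (U ∪ K).card ≤ s)
    {e : EuclideanSpace ℝ (Fin n)} (he : restrict U e = e) :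
    ‖restrict K (e - apply A.transpose (apply A e))‖ ≤ ric A s * ‖e‖ := by
  set r := e - apply A.transpose (apply A e) with hr
  set v := restrict K r with hv
  -- Test the residual against its own window `v`: the span of `e` and `v` lives on `U ∪ K`, so the
  -- isometry property bounds the quadratic form of `I - AᵀA` there.
  have h := abs_inner_le_of_quadratic (isSymmetric_sub_gram (A := A)) (δ := ric A s)
    (e := e) (v := v) fun a b => by
      have hz : restrict (U ∪ K) (a • e + b • v) = a • e + b • v := by
        rw [restrict_add, restrict_smul, restrict_smul,
          restrict_eq_self_of_subset Finset.subset_union_left he, hv,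
          restrict_restrict_of_subset Finset.subset_union_right]
      generalize a • e + b • v = z at hz
      simp only [LinearMap.sub_apply, LinearMap.id_apply, LinearMap.comp_apply, inner_sub_left]
      rw [inner_apply_transpose, real_inner_self_eq_norm_sq, real_inner_self_eq_norm_sq, abs_le]
      constructor
      · linarith [norm_apply_sq_le (A := A) hUK hz]
      · linarith [le_norm_apply_sq (A := A) hUK hz]
  simp only [LinearMap.sub_apply, LinearMap.id_apply, LinearMap.comp_apply] at h
  rw [← hr, real_inner_comm, hv, inner_restrict_left, ← hv, real_inner_self_eq_norm_sq,
    abs_of_nonneg (by positivity)] at h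
  rcases (norm_nonneg v).eq_or_lt with h0 | h0
  · rw [← h0]; exact mul_nonneg (ric_nonneg _ _) (norm_nonneg _)
  · exact le_of_mul_le_mul_right (by linarith) h0

/-- Duality: pairing the window `v` of `Aᵀη` with itself gives `⟨η, Av⟩`, and `v` is sparse. -/
theorem norm_restrict_transpose_le {s : ℕ} {K : Finset (Fin n)} (hK : K.card ≤ s)
    (η : EuclideanSpace ℝ (Fin m)) :
    ‖restrict K (apply A.transpose η)‖ ≤ √(1 + ric A s) * ‖η‖ := by
  set v := restrict K (apply A.transpose η) with hv
  have h1 : ‖v‖ ^ 2 = inner ℝ η (apply A v) := by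
    rw [← inner_apply_transpose, real_inner_comm]
    conv_rhs => rw [hv, inner_restrict_left, ← hv, real_inner_self_eq_norm_sq]
  have h2 : inner ℝ η (apply A v) ≤ ‖η‖ * ‖apply A v‖ := real_inner_le_norm _ _
  have h3 := norm_apply_le (A := A) hK (x := v) (restrict_restrict _ _)
  rcases (norm_nonneg v).eq_or_lt with h0 | h0
  · rw [← h0]; positivity
  · refine le_of_mul_le_mul_right ?_ h0
    nlinarith [norm_nonneg η]

end RestrictedIsometry

/-! ### From windows of length `k` to the whole vector. -/

section Blocks

variable {n : ℕ}

theorem card_block_le {k : ℕ} (hk : 1 ≤ k) (j : ℕ) :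
    (Finset.univ.filter fun i : Fin n => i.val / k = j).card ≤ k := by
  conv_rhs => rw [← Finset.card_range k]
  refine Finset.card_le_card_of_injOn (fun i => i.val % k)
    (fun i _ => by simpa using Nat.mod_lt _ hk) fun a ha b hb hab => ?_
  simp only [Finset.coe_filter, Finset.mem_univ, true_and, Set.mem_ofPred_eq] at ha hb hab
  ext
  rw [← Nat.div_add_mod a.val k, ← Nat.div_add_mod b.val k, ha, hb, hab]

/-- A bound on every window of length `k` bounds the whole vector up to `√⌈n / k⌉`. -/
theorem norm_le_sqrt_blocks_mul {k : ℕ} (hk : 1 ≤ k) {C : ℝ} (hC : 0 ≤ C)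
    (v : EuclideanSpace ℝ (Fin n))
    (h : ∀ K : Finset (Fin n), K.card ≤ k → ‖restrict K v‖ ≤ C) :
    ‖v‖ ≤ √(blocks n k) * C := by
  have hb : 0 ≤ blocks n k := Nat.cast_nonneg _
  refine (abs_le_of_sq_le_sq' ?_ (by positivity)).2
  rw [mul_pow, Real.sq_sqrt hb, EuclideanSpace.real_norm_sq_eq]
  have hmaps : ∀ i ∈ (Finset.univ : Finset (Fin n)),
      i.val / k ∈ Finset.range ⌈(n : ℝ) / (k : ℝ)⌉₊ := by
    intro i _
    rw [Finset.mem_range, Nat.div_lt_iff_lt_mul hk]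
    refine i.isLt.trans_le ?_
    have h1 := Nat.le_ceil ((n : ℝ) / k)
    rw [div_le_iff₀ (by exact_mod_cast hk)] at h1
    exact_mod_cast h1
  -- The fibres of `i ↦ i / k` are the blocks; squared norms add over them.
  rw [← Finset.sum_fiberwise_of_maps_to hmaps]
  calc _ ≤ ∑ j ∈ Finset.range ⌈(n : ℝ) / (k : ℝ)⌉₊, C ^ 2 := by
        refine Finset.sum_le_sum fun j _ => ?_
        rw [← norm_restrict_sq]
        exact pow_le_pow_left₀ (norm_nonneg _) (h _ (card_block_le hk j)) 2
    _ = _ := by simp [blocks]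

end Blocks


/-! ### Spectral bounds for the compressed Newton operator. -/

section Newton

variable {m n : ℕ} {A : Matrix (Fin m) (Fin n) ℝ}

theorem cols_mulVec (Ω : Finset (Fin n)) (g : Ω → ℝ) :
    (cols A Ω).mulVec g =
      (apply A (WithLp.toLp 2 fun i => if h : i ∈ Ω then g ⟨i, h⟩ else 0)).ofLp := by
  funext i
  rw [apply_coord]
  simp only [Matrix.mulVec, dotProduct, cols, Matrix.submatrix_apply, id]
  rw [← Finset.sum_subset (Finset.subset_univ Ω)
    (fun j _ hj => by simp [hj]), ← Finset.sum_coe_sort Ω]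
  exact Finset.sum_congr rfl fun j _ => by simp

/-- A kernel vector `g` has `‖A_Ω g‖² = 0`, and the lower isometry bound forces `g = 0`. Thus the
matrix inverse in `newtonMatrix` is a true inverse, not the default value. -/
theorem isUnit_gram {s : ℕ} {Ω : Finset (Fin n)} (hΩ : Ω.card ≤ s) (hs : ric A s < 1) :
    IsUnit ((cols A Ω).transpose * cols A Ω).det := by
  rw [← Matrix.isUnit_iff_isUnit_det, ← Matrix.mulVec_injective_iff_isUnit]
  refine (injective_iff_map_eq_zero (Matrix.mulVecLin _)).2 fun g hg => ?_
  have h0 : (cols A Ω).mulVec g = 0 := by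
    have : (cols A Ω).mulVec g ⬝ᵥ (cols A Ω).mulVec g = 0 := by
      rw [Matrix.dotProduct_mulVec, Matrix.vecMul_mulVec, ← Matrix.dotProduct_mulVec]
      exact (congrArg (g ⬝ᵥ ·) hg).trans (dotProduct_zero g)
    exact dotProduct_self_eq_zero.1 this
  rw [cols_mulVec] at h0
  set x : EuclideanSpace ℝ (Fin n) :=
    WithLp.toLp 2 fun i => if h : i ∈ Ω then g ⟨i, h⟩ else 0 with hx
  have hx' : restrict Ω x = x := by
    ext i; by_cases h : i ∈ Ω <;> simp [hx, h]
  have h1 := le_norm_apply_sq (A := A) hΩ hx'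
  have h2 : apply A x = 0 := by ext i; exact congrFun h0 i
  rw [h2, norm_zero] at h1
  have h3 : x = 0 := by
    have : ‖x‖ ^ 2 ≤ 0 := by
      by_contra! hc
      nlinarith
    simpa using le_antisymm this (sq_nonneg _)
  funext i
  have := congrArg (fun z : EuclideanSpace ℝ (Fin n) => z i) h3
  simpa [hx] using this

theorem newton_apply_of_notMem {α γ : ℝ} {Ω : Finset (Fin n)} (v : EuclideanSpace ℝ (Fin n))
    {i : Fin n} (hi : i ∉ Ω) :
    apply (newtonMatrix A α Ω * scaleMatrix γ Ω) v i = α * γ * v i := by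
  rw [apply_coord, Finset.sum_eq_single i]
  · simp [scaleMatrix, newtonMatrix, hi]
  · intro j _ hj
    simp [scaleMatrix, newtonMatrix, hi, hj.symm]
  · simp

theorem newton_apply_of_mem {α γ : ℝ} {Ω : Finset (Fin n)} (v : EuclideanSpace ℝ (Fin n))
    (i : Ω) :
    apply (newtonMatrix A α Ω * scaleMatrix γ Ω) v i =
      (((cols A Ω).transpose * cols A Ω)⁻¹).mulVec (fun j : Ω => v j) i := by
  rw [apply_coord, ← Finset.sum_subset (Finset.subset_univ Ω), ← Finset.sum_coe_sort Ω]
  · exact Finset.sum_congr rfl fun j _ => by simp [scaleMatrix, newtonMatrix]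
  · intro j _ hj
    have : (i : Fin n) ≠ j := fun h => hj (h ▸ i.2)
    simp [scaleMatrix, newtonMatrix, hj, this]

/-- The scaling is scalar on each of the two diagonal blocks, so the product stays symmetric; this
lets operator norms be read off from quadratic forms. -/
theorem newton_isSymmetric (α γ : ℝ) (Ω : Finset (Fin n)) :
    (Matrix.toEuclideanLin (newtonMatrix A α Ω * scaleMatrix γ Ω)).IsSymmetric := by
  have hG : (((cols A Ω).transpose * cols A Ω)⁻¹).transpose =
      ((cols A Ω).transpose * cols A Ω)⁻¹ := by
    rw [Matrix.transpose_nonsing_inv, Matrix.transpose_mul, Matrix.transpose_transpose]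
  have hT : (newtonMatrix A α Ω * scaleMatrix γ Ω).transpose =
      newtonMatrix A α Ω * scaleMatrix γ Ω := by
    ext i j
    simp only [Matrix.transpose_apply, scaleMatrix, Matrix.mul_diagonal, newtonMatrix]
    by_cases hi : i ∈ Ω <;> by_cases hj : j ∈ Ω
    · simp only [hi, hj, and_self, dif_pos, if_true, mul_one]
      exact congrFun (congrFun hG ⟨i, hi⟩) ⟨j, hj⟩
    · have : i ≠ j := fun h => hj (h ▸ hi)
      simp [hi, hj, this, this.symm]
    · have : i ≠ j := fun h => hi (h ▸ hj)
      simp [hi, hj, this, this.symm]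
    · rcases eq_or_ne i j with rfl | h
      · simp [hi]
      · simp [hi, hj, h, h.symm]
  intro x y
  have := inner_apply_transpose (newtonMatrix A α Ω * scaleMatrix γ Ω) x y
  rwa [hT] at this

/-- On `Ω`, the Newton matrix solves the normal equations. -/
theorem restrict_gram_newton {s : ℕ} {α γ : ℝ} {Ω : Finset (Fin n)} (hΩ : Ω.card ≤ s)
    (hs : ric A s < 1) (v : EuclideanSpace ℝ (Fin n)) :
    restrict Ω (apply A.transpose (apply A
      (restrict Ω (apply (newtonMatrix A α Ω * scaleMatrix γ Ω) v)))) = restrict Ω v := by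
  set G := (cols A Ω).transpose * cols A Ω with hG
  set g := G⁻¹.mulVec (fun j : Ω => v j) with hg
  have h1 : restrict Ω (apply (newtonMatrix A α Ω * scaleMatrix γ Ω) v) =
      WithLp.toLp 2 fun i => if h : i ∈ Ω then g ⟨i, h⟩ else 0 := by
    ext i
    by_cases h : i ∈ Ω
    · simpa [h] using newton_apply_of_mem v ⟨i, h⟩
    · simp [h]
  have h2 : G.mulVec g = fun j : Ω => v j := by
    rw [hg, Matrix.mulVec_mulVec, Matrix.mul_nonsing_inv _ (isUnit_gram hΩ hs), Matrix.one_mulVec]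
  ext i
  by_cases h : i ∈ Ω
  · have h3 := congrFun h2 ⟨i, h⟩
    rw [hG, ← Matrix.mulVec_mulVec, cols_mulVec, ← h1] at h3
    simp only [restrict_apply, h, if_true]
    exact h3
  · simp [h]

/-- Off `Ω` the operator is the scalar `αγ`. On `Ω`, with `a = v_Ω` and `g = (Pv)_Ω`, the normal
equations give `⟨g, a⟩ = ‖Ag‖²` and `‖a‖² = ⟨Ag, Aa⟩`; Cauchy–Schwarz and the isometry bounds for
`g` and `a` then yield the upper and lower estimates respectively. -/
theorem newton_quadratic_bounds {s : ℕ} {α γ : ℝ} {Ω : Finset (Fin n)} (hΩ : Ω.card ≤ s)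
    (hs : ric A s < 1) (h1 : 1 / (1 + ric A s) ≤ α * γ) (h2 : α * γ ≤ 1 / (1 - ric A s))
    (v : EuclideanSpace ℝ (Fin n)) :
    1 / (1 + ric A s) * ‖v‖ ^ 2 ≤
        inner ℝ (apply (newtonMatrix A α Ω * scaleMatrix γ Ω) v) v ∧
      inner ℝ (apply (newtonMatrix A α Ω * scaleMatrix γ Ω) v) v ≤
        1 / (1 - ric A s) * ‖v‖ ^ 2 := by
  have hδ := ric_nonneg A s
  have hp : 0 < 1 + ric A s := by linarith
  have hm : 0 < 1 - ric A s := by linarith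
  have hgram := restrict_gram_newton (α := α) (γ := γ) hΩ hs v
  have hoff : restrict Ωᶜ (apply (newtonMatrix A α Ω * scaleMatrix γ Ω) v) =
      (α * γ) • restrict Ωᶜ v := by
    ext i
    by_cases h : i ∈ Ω
    · simp [h]
    · simpa [h] using newton_apply_of_notMem v h
  set Pv := apply (newtonMatrix A α Ω * scaleMatrix γ Ω) v
  set g := restrict Ω Pv with hg
  have hgg : restrict Ω g = g := restrict_restrict _ _
  set a := restrict Ω v with ha
  have haa : restrict Ω a = a := restrict_restrict _ _
  have hin : inner ℝ Pv v = inner ℝ g a + α * γ * ‖restrict Ωᶜ v‖ ^ 2 := by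
    conv_lhs => rw [← restrict_add_restrict_compl Ω Pv, inner_add_left, inner_restrict_left,
      inner_restrict_left Ωᶜ, hoff, real_inner_smul_left, real_inner_self_eq_norm_sq]
  have hga : inner ℝ g a = ‖apply A g‖ ^ 2 := by
    rw [← hgram, ← hgg, ← inner_restrict_left, hgg, real_inner_comm, inner_apply_transpose,
      real_inner_self_eq_norm_sq]
  have haA : ‖a‖ ^ 2 = inner ℝ (apply A g) (apply A a) := by
    rw [← inner_apply_transpose, real_inner_comm, ha, inner_restrict_left, hgram, ← ha,
      real_inner_self_eq_norm_sq]
  have hup : ‖apply A g‖ ^ 2 ≤ 1 / (1 - ric A s) * ‖a‖ ^ 2 := by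
    have e1 := le_norm_apply_sq (A := A) hΩ hgg
    have e2 : ‖apply A g‖ ^ 2 ≤ ‖g‖ * ‖a‖ := hga ▸ real_inner_le_norm _ _
    rw [one_div, inv_mul_eq_div, le_div_iff₀ hm]
    have e3 : (1 - ric A s) * ‖g‖ ≤ ‖a‖ := by
      rcases (norm_nonneg g).eq_or_lt with h0 | h0
      · rw [← h0, mul_zero]; positivity
      · exact le_of_mul_le_mul_right (by linarith) h0
    calc _ ≤ ‖g‖ * ‖a‖ * (1 - ric A s) := mul_le_mul_of_nonneg_right e2 hm.le
      _ = ((1 - ric A s) * ‖g‖) * ‖a‖ := by ring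
      _ ≤ ‖a‖ * ‖a‖ := mul_le_mul_of_nonneg_right e3 (norm_nonneg _)
      _ = _ := by ring
  have hlo : 1 / (1 + ric A s) * ‖a‖ ^ 2 ≤ ‖apply A g‖ ^ 2 := by
    have e1 := norm_apply_sq_le (A := A) hΩ haa
    have e2 : ‖a‖ ^ 2 ≤ ‖apply A g‖ * ‖apply A a‖ := haA ▸ real_inner_le_norm _ _
    rw [one_div, inv_mul_eq_div, div_le_iff₀ hp]
    have e3 : (‖a‖ ^ 2) ^ 2 ≤ ‖apply A g‖ ^ 2 * ((1 + ric A s) * ‖a‖ ^ 2) :=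
      calc _ ≤ (‖apply A g‖ * ‖apply A a‖) ^ 2 := pow_le_pow_left₀ (sq_nonneg _) e2 2
        _ = ‖apply A g‖ ^ 2 * ‖apply A a‖ ^ 2 := mul_pow _ _ _
        _ ≤ _ := mul_le_mul_of_nonneg_left e1 (sq_nonneg _)
    rcases (sq_nonneg ‖a‖).eq_or_lt with h0 | h0
    · rw [← h0]; positivity
    · exact le_of_mul_le_mul_right (by linarith) h0
  have hb : 0 ≤ ‖restrict Ωᶜ v‖ ^ 2 := sq_nonneg _
  rw [hin, hga, norm_sq_eq_restrict_add_compl Ω v]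
  constructor
  · linarith [mul_le_mul_of_nonneg_right h1 hb]
  · linarith [mul_le_mul_of_nonneg_right h2 hb]

/-- A symmetric operator with quadratic form bounded by `c ‖·‖²` has norm at most `c`. -/
theorem norm_le_of_quadratic {E : Type*} [NormedAddCommGroup E] [InnerProductSpace ℝ E]
    {T : E →ₗ[ℝ] E} (hT : T.IsSymmetric) {c : ℝ} (hc : 0 ≤ c)
    (h : ∀ z, |inner ℝ (T z) z| ≤ c * ‖z‖ ^ 2) (v : E) : ‖T v‖ ≤ c * ‖v‖ := by
  have h1 := abs_inner_le_of_quadratic hT (e := v) (v := T v) fun a b => h _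
  rw [real_inner_self_eq_norm_sq, abs_of_nonneg (sq_nonneg _)] at h1
  rcases (norm_nonneg (T v)).eq_or_lt with h0 | h0
  · rw [← h0]; positivity
  · exact le_of_mul_le_mul_right (by linarith) h0

theorem norm_newton_apply_le {s : ℕ} {α γ : ℝ} {Ω : Finset (Fin n)} (hΩ : Ω.card ≤ s)
    (hs : ric A s < 1) (h1 : 1 / (1 + ric A s) ≤ α * γ) (h2 : α * γ ≤ 1 / (1 - ric A s))
    (v : EuclideanSpace ℝ (Fin n)) :
    ‖apply (newtonMatrix A α Ω * scaleMatrix γ Ω) v‖ ≤ 1 / (1 - ric A s) * ‖v‖ := by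
  have hδ := ric_nonneg A s
  have hm : 0 < 1 - ric A s := by linarith
  refine norm_le_of_quadratic (newton_isSymmetric α γ Ω) (by positivity) (fun z => ?_) v
  obtain ⟨e1, e2⟩ := newton_quadratic_bounds hΩ hs h1 h2 z
  rw [abs_of_nonneg (le_trans (by positivity) e1)]
  exact e2

theorem norm_sub_smul_newton_apply_le {s : ℕ} {lam α γ : ℝ} {Ω : Finset (Fin n)}
    (hΩ : Ω.card ≤ s) (hs : ric A s < 1) (hlam : 0 ≤ lam)
    (h1 : 1 / (1 + ric A s) ≤ α * γ) (h2 : α * γ ≤ 1 / (1 - ric A s))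
    (v : EuclideanSpace ℝ (Fin n)) :
    ‖v - lam • apply (newtonMatrix A α Ω * scaleMatrix γ Ω) v‖ ≤
      Delta lam (ric A s) * ‖v‖ := by
  set P := Matrix.toEuclideanLin (newtonMatrix A α Ω * scaleMatrix γ Ω) with hP
  have hsym : (LinearMap.id - lam • P).IsSymmetric := by
    intro x y
    have := newton_isSymmetric (A := A) α γ Ω x y
    simp only [LinearMap.sub_apply, LinearMap.id_apply, LinearMap.smul_apply, inner_sub_left,
      inner_sub_right, real_inner_smul_left, real_inner_smul_right]
    rw [hP, this]
  refine norm_le_of_quadratic hsym (le_max_of_le_left (abs_nonneg _)) (fun z => ?_) v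
  obtain ⟨e1, e2⟩ := newton_quadratic_bounds hΩ hs h1 h2 z
  simp only [LinearMap.sub_apply, LinearMap.id_apply, LinearMap.smul_apply, inner_sub_left,
      real_inner_smul_left, real_inner_self_eq_norm_sq]
  have hz := sq_nonneg ‖z‖
  have e3 := mul_le_mul_of_nonneg_left e1 hlam
  have e4 := mul_le_mul_of_nonneg_left e2 hlam
  have m1 := neg_le_of_abs_le (le_max_left |1 - lam / (1 - ric A s)| |1 - lam / (1 + ric A s)|)
  have m2 := (le_abs_self _).trans
    (le_max_right |1 - lam / (1 - ric A s)| |1 - lam / (1 + ric A s)|)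
  generalize max |1 - lam / (1 - ric A s)| |1 - lam / (1 + ric A s)| = M at m1 m2 ⊢
  rw [div_eq_mul_one_div lam] at m1 m2
  have m3 := mul_le_mul_of_nonneg_right m1 hz
  have m4 := mul_le_mul_of_nonneg_right m2 hz
  change |‖z‖ ^ 2 - lam * inner ℝ (apply (newtonMatrix A α Ω * scaleMatrix γ Ω) z) z| ≤ _
  rw [abs_le]
  constructor
  · linarith
  · linarith

end Newton

/-! ### Vertices of the capped simplex. -/

section Weights

variable {n : ℕ}

theorem relaxedWeights_convex (n k : ℕ) : Convex ℝ (relaxedWeights n k) := by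
  intro u hu v hv a b ha hb hab
  refine ⟨?_, fun i => ⟨?_, ?_⟩⟩
  · simp [Finset.sum_add_distrib, ← Finset.mul_sum, hu.1, hv.1, ← add_mul, hab]
  · have := mul_nonneg ha (hu.2 i).1
    have := mul_nonneg hb (hv.2 i).1
    simp; linarith
  · have := mul_le_mul_of_nonneg_left (hu.2 i).2 ha
    have := mul_le_mul_of_nonneg_left (hv.2 i).2 hb
    simp; linarith

theorem relaxedWeights_isCompact (n k : ℕ) : IsCompact (relaxedWeights n k) := by
  refine Metric.isCompact_of_isClosed_isBounded ?_ ?_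
  · have h1 : IsClosed {w : EuclideanSpace ℝ (Fin n) | ∑ i, w i = (k : ℝ)} :=
      isClosed_eq (by fun_prop) continuous_const
    have h2 : IsClosed {w : EuclideanSpace ℝ (Fin n) | ∀ i, 0 ≤ w i ∧ w i ≤ 1} := by
      simp only [Set.ofPred_forall, Set.ofPred_and]
      exact isClosed_iInter fun i => (isClosed_le continuous_const (by fun_prop)).inter
        (isClosed_le (by fun_prop) continuous_const)
    exact h1.inter h2
  · refine (Metric.isBounded_closedBall (x := 0) (r := √n)).subset fun w hw => ?_
    rw [mem_closedBall_zero_iff]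
    refine Real.le_sqrt_of_sq_le ?_
    rw [EuclideanSpace.real_norm_sq_eq]
    calc _ ≤ ∑ _i : Fin n, (1 : ℝ) :=
          Finset.sum_le_sum fun i _ => pow_le_one₀ (hw.2 i).1 (hw.2 i).2
      _ = _ := by simp

/-- The extreme points of the capped simplex are indicators of `k`-element sets. -/
theorem extremePoints_relaxedWeights {k : ℕ} {w : EuclideanSpace ℝ (Fin n)}
    (hw : w ∈ Set.extremePoints ℝ (relaxedWeights n k)) :
    ∃ K : Finset (Fin n), K.card = k ∧ ∀ v, hadamard w v = restrict K v := by
  obtain ⟨hmem, hext⟩ := mem_extremePoints.1 hw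
  have h01 : ∀ i, w i = 0 ∨ w i = 1 := by
    by_contra! hcon
    obtain ⟨i, hi0, hi1⟩ := hcon
    have hi0' : 0 < w i := lt_of_le_of_ne (hmem.2 i).1 hi0.symm
    have hi1' : w i < 1 := lt_of_le_of_ne (hmem.2 i).2 hi1
    -- A single fractional coordinate is impossible, because the total `k` is an integer.
    have hj : ∃ j ≠ i, w j ≠ 0 ∧ w j ≠ 1 := by
      by_contra! hcon
      have hsum : w i + ((Finset.univ.erase i).filter fun j => w j = 1).card = k := by
        rw [← hmem.1, ← Finset.add_sum_erase _ _ (Finset.mem_univ i), Finset.card_filter]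
        push_cast
        congr 1
        refine Finset.sum_congr rfl fun j hj => ?_
        by_cases h0 : w j = 0
        · simp [h0]
        · simp [hcon j (Finset.ne_of_mem_erase hj) h0]
      set c := ((Finset.univ.erase i).filter fun j => w j = 1).card
      have a1 : (c : ℝ) < k := by linarith
      have a2 : (k : ℝ) < c + 1 := by linarith
      norm_cast at a1 a2
      omega
    obtain ⟨j, hji, hj0, hj1⟩ := hj
    have hj0' : 0 < w j := lt_of_le_of_ne (hmem.2 j).1 hj0.symm
    have hj1' : w j < 1 := lt_of_le_of_ne (hmem.2 j).2 hj1
    obtain ⟨t, ht, t1, t2, t3, t4⟩ : ∃ t : ℝ, 0 < t ∧ t ≤ w i ∧ t ≤ 1 - w i ∧ t ≤ w j ∧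
        t ≤ 1 - w j := by
      refine ⟨min (min (w i) (1 - w i)) (min (w j) (1 - w j)), ?_, ?_, ?_, ?_, ?_⟩
      · simp [hi0', hi1', hj0', hj1']
      all_goals simp
    -- Shifting mass `t` between the two fractional coordinates, in either direction, stays
    -- feasible, so `w` would be a proper midpoint.
    set d : EuclideanSpace ℝ (Fin n) := EuclideanSpace.single i t - EuclideanSpace.single j t
      with hd
    have hdi : d i = t := by simp [hd, hji.symm]
    have hdj : d j = -t := by simp [hd, hji]
    have hdl : ∀ l, l ≠ i → l ≠ j → d l = 0 := fun l h1 h2 => by simp [hd, h1, h2]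
    have hds : ∑ l, d l = 0 := by simp [hd]
    have key : ∀ ε : ℝ, (ε = 1 ∨ ε = -1) → w + ε • d ∈ relaxedWeights n k := by
      intro ε hε
      refine ⟨?_, fun l => ?_⟩
      · simp [Finset.sum_add_distrib, ← Finset.mul_sum, hds, hmem.1]
      · rcases eq_or_ne l i with rfl | h1
        · rcases hε with rfl | rfl <;> simp only [PiLp.add_apply, PiLp.smul_apply, smul_eq_mul, hdi]
            <;> constructor <;> linarith
        rcases eq_or_ne l j with rfl | h2
        · rcases hε with rfl | rfl <;> simp only [PiLp.add_apply, PiLp.smul_apply, smul_eq_mul, hdj]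
            <;> constructor <;> linarith
        · simpa [hdl l h1 h2] using hmem.2 l
    have := (hext _ (key 1 (Or.inl rfl)) _ (key (-1) (Or.inr rfl))
      ⟨1 / 2, 1 / 2, by norm_num, by norm_num, by norm_num, by module⟩).1
    have h := congrArg (fun z : EuclideanSpace ℝ (Fin n) => z i) this
    simp [hdi] at h
    linarith
  refine ⟨Finset.univ.filter fun i => w i = 1, ?_, fun v => ?_⟩
  · have h := hmem.1
    rw [Finset.card_filter]
    rw [← Nat.cast_inj (R := ℝ), ← h]
    push_cast
    refine Finset.sum_congr rfl fun i _ => ?_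
    rcases h01 i with h | h <;> simp [h]
  · ext i
    rcases h01 i with h | h <;> simp [h]

/-- A convex continuous function on the capped simplex is bounded by its values at the vertices. -/
theorem hadamard_bound {m k : ℕ} {C : ℝ}
    (f : EuclideanSpace ℝ (Fin n) →ₗ[ℝ] EuclideanSpace ℝ (Fin m)) (v : EuclideanSpace ℝ (Fin n))
    (h : ∀ K : Finset (Fin n), K.card = k → ‖f (restrict K v)‖ ≤ C)
    {w : EuclideanSpace ℝ (Fin n)} (hw : w ∈ relaxedWeights n k) :
    ‖f (hadamard w v)‖ ≤ C := by
  let H : EuclideanSpace ℝ (Fin n) →ₗ[ℝ] EuclideanSpace ℝ (Fin n) :=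
    { toFun := fun w => hadamard w v
      map_add' := fun a b => by ext i; simp [add_mul]
      map_smul' := fun a b => by ext i; simp [mul_assoc] }
  let F := (f ∘ₗ H).toContinuousLinearMap
  have hcl : IsClosed {w | ‖F w‖ ≤ C} := isClosed_le (by fun_prop) continuous_const
  have hcv : Convex ℝ {w | ‖F w‖ ≤ C} := by
    have : {w | ‖F w‖ ≤ C} = F ⁻¹' Metric.closedBall 0 C := by ext; simp
    rw [this]
    exact (convex_closedBall 0 C).is_linear_preimage F.toLinearMap.isLinear
  have hsub : relaxedWeights n k ⊆ {w | ‖F w‖ ≤ C} := by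
    -- Krein–Milman: the sublevel set is closed and convex, so it suffices that it contains the
    -- vertices.
    rw [← closure_convexHull_extremePoints (relaxedWeights_isCompact n k)
      (relaxedWeights_convex n k)]
    refine closure_minimal (convexHull_min (fun e he => ?_) hcv) hcl
    obtain ⟨K, hK, hKe⟩ := extremePoints_relaxedWeights he
    change ‖f (hadamard e v)‖ ≤ C
    rw [hKe]
    exact h K hK
  exact hsub hw

end Weights


/-! ### One iteration: Newton step, optimal weights, hard thresholding. -/

section Iteration

variable {m n : ℕ} {A : Matrix (Fin m) (Fin n) ℝ}

/-- The two differences have equally many elements, and every entry of `z` on `T \ S` dominates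
every entry on `S \ T`. -/
theorem norm_restrict_sdiff_le {S T : Finset (Fin n)} (hST : S.card = T.card)
    {z : EuclideanSpace ℝ (Fin n)} (hz : ∀ i ∈ T, ∀ j ∉ T, |z j| ≤ |z i|) :
    ‖restrict (S \ T) z‖ ≤ ‖restrict (T \ S) z‖ := by
  refine (abs_le_of_sq_le_sq' ?_ (norm_nonneg _)).2
  rw [norm_restrict_sq, norm_restrict_sq]
  rcases (S \ T).eq_empty_or_nonempty with h | h
  · rw [h, Finset.sum_empty]
    exact Finset.sum_nonneg fun i _ => sq_nonneg _
  obtain ⟨j, hj, hmax⟩ := Finset.exists_max_image _ (fun i => z i ^ 2) h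
  calc _ ≤ (S \ T).card • z j ^ 2 := Finset.sum_le_card_nsmul _ _ _ hmax
    _ = (T \ S).card • z j ^ 2 := by rw [Finset.card_sdiff_comm hST]
    _ ≤ _ := Finset.card_nsmul_le_sum _ _ _ fun i hi =>
      sq_le_sq.2 (hz i (Finset.mem_sdiff.1 hi).1 j (Finset.mem_sdiff.1 hj).2)

/-- `φ²` is the largest eigenvalue of the form `(s + t)² + t²`: the gap `φ²(s² + t²) - (s + t)² -
t²` equals `(φs - t)²/φ`. -/
theorem goldenRatio_quadratic {b s t : ℝ} (hb : 0 ≤ b) (hbs : b ≤ s + t) :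
    b ^ 2 + t ^ 2 ≤ Real.goldenRatio ^ 2 * (s ^ 2 + t ^ 2) := by
  have h1 := Real.goldenRatio_pos
  have h2 := Real.goldenRatio_sq
  have h3 : b ^ 2 ≤ (s + t) ^ 2 := pow_le_pow_left₀ hb hbs 2
  have h4 : 0 ≤ (Real.goldenRatio * s - t) ^ 2 := sq_nonneg _
  have h5 : (Real.goldenRatio * s - t) ^ 2 = Real.goldenRatio *
      (Real.goldenRatio * s ^ 2 - 2 * s * t + (Real.goldenRatio - 1) * t ^ 2) := by
    linear_combination -t ^ 2 * h2
  rw [h5] at h4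
  have h6 := nonneg_of_mul_nonneg_right h4 h1
  rw [h2]
  nlinarith

/-- Hard thresholding is within a factor `φ` of the best approximation on the joint support. -/
theorem norm_hardThreshold_sub_le {S T : Finset (Fin n)} (hST : S.card = T.card)
    {z x : EuclideanSpace ℝ (Fin n)} (hx : restrict S x = x)
    (hz : ∀ i ∈ T, ∀ j ∉ T, |z j| ≤ |z i|) :
    ‖restrict T z - x‖ ≤ Real.goldenRatio * ‖restrict (S ∪ T) (z - x)‖ := by
  have hx0 : ∀ i ∉ S, x i = 0 := fun i hi => by rw [← hx]; simp [hi]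
  have e1 : ‖restrict T z - x‖ ^ 2 = ‖restrict (S ∩ T) (z - x)‖ ^ 2 +
      (‖restrict (S \ T) x‖ ^ 2 + ‖restrict (T \ S) z‖ ^ 2) := by
    simp only [EuclideanSpace.real_norm_sq_eq, ← Finset.sum_add_distrib]
    refine Finset.sum_congr rfl fun i _ => ?_
    by_cases h1 : i ∈ S <;> by_cases h2 : i ∈ T <;> simp [h1, h2, hx0]
  have e2 : ‖restrict (S ∪ T) (z - x)‖ ^ 2 = ‖restrict (S ∩ T) (z - x)‖ ^ 2 +
      (‖restrict (S \ T) (z - x)‖ ^ 2 + ‖restrict (T \ S) z‖ ^ 2) := by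
    simp only [EuclideanSpace.real_norm_sq_eq, ← Finset.sum_add_distrib]
    refine Finset.sum_congr rfl fun i _ => ?_
    by_cases h1 : i ∈ S <;> by_cases h2 : i ∈ T <;> simp [h1, h2, hx0]
  -- Apart from the common part on `S ∩ T`, these are the `b`, `s`, `t` of `goldenRatio_quadratic`.
  have e3 : ‖restrict (S \ T) x‖ ≤ ‖restrict (S \ T) (z - x)‖ + ‖restrict (T \ S) z‖ :=
    calc ‖restrict (S \ T) x‖ = ‖restrict (S \ T) z - restrict (S \ T) (z - x)‖ := by
          rw [← restrict_sub, sub_sub_cancel]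
      _ ≤ ‖restrict (S \ T) z‖ + ‖restrict (S \ T) (z - x)‖ := norm_sub_le _ _
      _ ≤ _ := by linarith [norm_restrict_sdiff_le hST hz]
  have e4 := goldenRatio_quadratic (norm_nonneg _) e3
  have hφ := Real.one_lt_goldenRatio
  refine (abs_le_of_sq_le_sq' ?_ (by positivity)).2
  rw [mul_pow, e1, e2]
  have hφ2 : 1 ≤ Real.goldenRatio ^ 2 := one_le_pow₀ hφ.le
  linarith [mul_le_mul_of_nonneg_right hφ2 (sq_nonneg ‖restrict (S ∩ T) (z - x)‖)]

/-- Error of the compressed Newton step on any window of length `k`. -/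
theorem norm_restrict_newtonStep_sub_le {k q : ℕ} (hk : 1 ≤ k) {lam α γ : ℝ}
    {y η : EuclideanSpace ℝ (Fin m)} {x x' : EuclideanSpace ℝ (Fin n)} {Ω U K : Finset (Fin n)}
    (hy : y = apply A x + η) (hU : U.card ≤ 2 * k) (hxU : restrict U (x - x') = x - x')
    (hΩ : Ω.card ≤ q) (hq : ric A q < 1) (hlam : 0 ≤ lam)
    (h1 : 1 / (1 + ric A q) ≤ α * γ) (h2 : α * γ ≤ 1 / (1 - ric A q)) (hK : K.card ≤ k) :
    ‖restrict K (newtonStep A y lam α γ Ω x' - x)‖ ≤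
      (ric A (3 * k) + Delta lam (ric A q) * (1 + √(blocks n k) * ric A (3 * k))) * ‖x' - x‖ +
        lam * √(blocks n k) * √(1 + ric A k) / (1 - ric A q) * ‖η‖ := by
  set e := x - x' with he
  have hd3 := ric_nonneg A (3 * k)
  have hm : 0 < 1 - ric A q := by linarith
  set h := apply A.transpose (apply A e) with hh
  set ν := apply A.transpose η with hν
  set P := Matrix.toEuclideanLin (newtonMatrix A α Ω * scaleMatrix γ Ω) with hP
  have hwin : ∀ K : Finset (Fin n), K.card ≤ k → ‖restrict K (e - h)‖ ≤ ric A (3 * k) * ‖e‖ := by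
    intro K hK
    refine norm_restrict_sub_gram_le ?_ hxU
    have := Finset.card_union_le U K
    omega
  have hall := norm_le_sqrt_blocks_mul hk (by positivity) _ hwin
  have hνn := norm_le_sqrt_blocks_mul hk (by positivity) ν
    fun K hK => norm_restrict_transpose_le (A := A) hK η
  have hhn : ‖h‖ ≤ (1 + √(blocks n k) * ric A (3 * k)) * ‖e‖ := by
    have : ‖h‖ ≤ ‖e‖ + ‖e - h‖ := by
      simpa using norm_sub_le e (e - h)
    linarith
  -- Only `e - h` is estimated through the window. The operator `P` mixes coordinates, so the other
  -- two terms need the full norms of `h` and `ν`.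
  have heq : newtonStep A y lam α γ Ω x' - x = -((e - h) + (h - lam • P h)) + lam • P ν := by
    have : y - apply A x' = apply A e + η := by
      rw [hy, he]; simp only [apply, map_sub]; abel
    have h3 : apply A.transpose (apply A e + η) = h + ν := map_add _ _ _
    rw [newtonStep, apply_mul, this, h3]
    change x' + lam • P (h + ν) - x = _
    rw [map_add, he]
    module
  have hΔ : 0 ≤ Delta lam (ric A q) := le_max_of_le_left (abs_nonneg _)
  have t2 : ‖h - lam • P h‖ ≤ Delta lam (ric A q) * ‖h‖ :=
    norm_sub_smul_newton_apply_le hΩ hq hlam h1 h2 h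
  have t3 : ‖P ν‖ ≤ 1 / (1 - ric A q) * ‖ν‖ := norm_newton_apply_le hΩ hq h1 h2 ν
  have hnorm : ‖x' - x‖ = ‖e‖ := norm_sub_rev _ _
  rw [heq, hnorm]
  calc _ ≤ ‖restrict K (e - h)‖ + ‖h - lam • P h‖ + lam * ‖P ν‖ := by
        have : restrict K (-((e - h) + (h - lam • P h)) + lam • P ν) =
            restrict K (lam • P ν - (h - lam • P h)) - restrict K (e - h) := by
          rw [← restrict_sub]; congr 1; abel
        rw [this]
        have a1 := norm_sub_le (restrict K (lam • P ν - (h - lam • P h))) (restrict K (e - h))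
        have a2 := norm_restrict_le K (lam • P ν - (h - lam • P h))
        have a3 := norm_sub_le (lam • P ν) (h - lam • P h)
        rw [norm_smul, Real.norm_of_nonneg hlam] at a3
        linarith
    _ ≤ ric A (3 * k) * ‖e‖ +
          Delta lam (ric A q) * ((1 + √(blocks n k) * ric A (3 * k)) * ‖e‖) +
          lam * (1 / (1 - ric A q) * (√(blocks n k) * (√(1 + ric A k) * ‖η‖))) := by
        have b2 := t2.trans (mul_le_mul_of_nonneg_left hhn hΔ)
        have b3 := mul_le_mul_of_nonneg_left
          (t3.trans (mul_le_mul_of_nonneg_left hνn (by positivity))) hlam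
        linarith [hwin K hK]
    _ = _ := by ring

/-- The relaxed optimal thresholding followed by hard thresholding. -/
theorem norm_optimalThreshold_sub_le {k : ℕ} {E : ℝ} {y η : EuclideanSpace ℝ (Fin m)}
    {x u w x'' : EuclideanSpace ℝ (Fin n)} {S : Finset (Fin n)} (hS : S.card ≤ k)
    (hxS : restrict S x = x) (hy : y = apply A x + η) (h2k : ric A (2 * k) < 1)
    (hE : ∀ K : Finset (Fin n), K.card ≤ k → ‖restrict K (u - x)‖ ≤ E)
    (hw : IsOptimalWeight A y k u w) (hx'' : IsHardThreshold k (hadamard w u) x'') :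
    ‖x'' - x‖ ≤ Real.goldenRatio / √(1 - ric A (2 * k)) *
      (2 * (√(1 + ric A k) * E) + 2 * ‖η‖) := by
  obtain ⟨hmem, hmin⟩ := hw
  -- Feasibility forces `k ≤ n`, so thresholding keeps exactly `k` indices and `S` can be padded to
  -- size `k`. The padded indicator is a feasible weight.
  have hkn : k ≤ n := by
    have : (k : ℝ) ≤ n := by
      rw [← hmem.1]
      calc _ ≤ ∑ _i : Fin n, (1 : ℝ) := Finset.sum_le_sum fun i _ => (hmem.2 i).2
        _ = _ := by simp
    exact_mod_cast this
  obtain ⟨T, hT, hTz, rfl⟩ := hx''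
  rw [min_eq_left hkn] at hT
  obtain ⟨S', hSS', hS'⟩ := Finset.exists_superset_card_eq hS (by simpa using hkn)
  have hxS' := restrict_eq_self_of_subset hSS' hxS
  have hpos : 0 < √(1 - ric A (2 * k)) := Real.sqrt_pos.2 (by linarith)
  have hφ := Real.goldenRatio_pos
  set z := hadamard w u with hz
  have hgold := norm_hardThreshold_sub_le (hS'.trans hT.symm) hxS' hTz
  set V := S' ∪ T with hV
  have hVc : V.card ≤ 2 * k := by
    have : V.card ≤ S'.card + T.card := Finset.card_union_le S' T
    omega
  have hxV : restrict V x = x := restrict_eq_self_of_subset Finset.subset_union_left hxS'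
  have hlow := sqrt_mul_norm_le_norm_apply (A := A) hVc h2k.le (restrict_restrict V (z - x))
  have htail : ‖apply A (restrict Vᶜ z)‖ ≤ √(1 + ric A k) * E := by
    let R : EuclideanSpace ℝ (Fin n) →ₗ[ℝ] EuclideanSpace ℝ (Fin n) :=
      { toFun := restrict Vᶜ
        map_add' := restrict_add _
        map_smul' := restrict_smul _ }
    have hb := hadamard_bound (k := k) (C := √(1 + ric A k) * E)
      (Matrix.toEuclideanLin A ∘ₗ R) (u - x) (fun K hK => by
        have hKs : restrict K (restrict Vᶜ (restrict K (u - x))) =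
            restrict Vᶜ (restrict K (u - x)) := by
          ext i; by_cases h : i ∈ K <;> simp [h]
        refine (norm_apply_le (A := A) hK.le hKs).trans ?_
        exact mul_le_mul_of_nonneg_left ((norm_restrict_le _ _).trans (hE K hK.le))
          (Real.sqrt_nonneg _)) hmem
    -- Since `x` vanishes off `V`, replacing `u` by `u - x` changes nothing there.
    have heq : restrict Vᶜ z = R (hadamard w (u - x)) := by
      ext i
      change _ = restrict Vᶜ (hadamard w (u - x)) i
      by_cases h : i ∈ V
      · simp [h]
      · have : x i = 0 := by rw [← hxV]; simp [h]
        simp [h, hz, this]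
    rw [heq]
    exact hb
  have hfit : ‖y - apply A z‖ ≤ √(1 + ric A k) * E + ‖η‖ := by
    set v : EuclideanSpace ℝ (Fin n) := WithLp.toLp 2 fun i => if i ∈ S' then 1 else 0 with hv
    have hvm : v ∈ relaxedWeights n k := by
      refine ⟨by simp [hv, hS'], fun i => ?_⟩
      by_cases h : i ∈ S' <;> simp [hv, h]
    have hvu : hadamard v u = restrict S' u := by
      ext i; by_cases h : i ∈ S' <;> simp [hv, h]
    -- Optimality against the indicator of `S'`, which leaves the residual `η - A(u - x)_{S'}`.
    have h3 := hmin hvm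
    simp only [Set.mem_ofPred_eq] at h3
    have h4 := (abs_le_of_sq_le_sq' h3 (norm_nonneg _)).2
    rw [hvu] at h4
    refine h4.trans ?_
    have h5 : y - apply A (restrict S' u) = η - apply A (restrict S' (u - x)) := by
      rw [restrict_sub, hxS', hy]; simp only [apply, map_sub]; abel
    rw [h5]
    have h6 := norm_apply_le (A := A) hS'.le (restrict_restrict S' (u - x))
    have h7 := mul_le_mul_of_nonneg_left (hE S' hS'.le) (Real.sqrt_nonneg (1 + ric A k))
    linarith [norm_sub_le η (apply A (restrict S' (u - x)))]
  have hmid : ‖apply A (restrict V (z - x))‖ ≤ 2 * (√(1 + ric A k) * E) + 2 * ‖η‖ := by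
    have h8 : apply A (restrict V (z - x)) = η - (y - apply A z) - apply A (restrict Vᶜ z) := by
      have : restrict V (z - x) = z - restrict Vᶜ z - x := by
        rw [restrict_sub, hxV]
        conv_rhs => rw [← restrict_add_restrict_compl V z]
        rw [restrict_add, restrict_restrict]
        ext i; by_cases h : i ∈ V <;> simp [h]
      rw [this, hy]; simp only [apply, map_sub]; abel
    rw [h8]
    linarith [norm_sub_le (η - (y - apply A z)) (apply A (restrict Vᶜ z)),
      norm_sub_le η (y - apply A z)]
  refine hgold.trans ?_
  rw [div_mul_eq_mul_div Real.goldenRatio, le_div_iff₀ hpos, mul_assoc]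
  refine mul_le_mul_of_nonneg_left ?_ hφ.le
  linarith

end Iteration

/-! ### The quintic, the stepsize range and the contraction factor. -/

section Constants

variable {m n : ℕ} {A : Matrix (Fin m) (Fin n) ℝ}

/-- Nonnegative coefficients and the linear term make the quintic strictly increasing on `[0, ∞)`;
it is `-1` at `0` and positive at `1`. -/
theorem exists_unique_quintic_root (n k : ℕ) :
    ∃ β : ℝ, (0 < β ∧ β < 1 ∧ quintic n k β = 0) ∧
      ∀ b : ℝ, 0 < b → b < 1 → quintic n k b = 0 → b = β := by
  have hN : 0 ≤ blocks n k := Nat.cast_nonneg _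
  have hφ := Real.goldenRatio_pos
  have hmono : StrictMonoOn (quintic n k) (Set.Ici 0) := by
    intro a ha b hb hab
    have ha : 0 ≤ a := ha
    unfold quintic
    have : 9 * Real.goldenRatio ^ 2 *
      (blocks n k * a ^ 5 + (blocks n k + 4 * √(blocks n k)) * a ^ 4
        + 4 * (√(blocks n k) + 1) * a ^ 3 + 4 * a ^ 2) ≤ 9 * Real.goldenRatio ^ 2 *
      (blocks n k * b ^ 5 + (blocks n k + 4 * √(blocks n k)) * b ^ 4
        + 4 * (√(blocks n k) + 1) * b ^ 3 + 4 * b ^ 2) := by gcongr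
    linarith
  have hcont : ContinuousOn (quintic n k) (Set.Icc 0 1) := by
    unfold quintic; fun_prop
  have h0 : quintic n k 0 < 0 := by simp [quintic]
  have h1 : 0 < quintic n k 1 := by simp only [quintic]; ring_nf; positivity
  obtain ⟨β, hβ, hβ0⟩ := intermediate_value_Ioo zero_le_one hcont ⟨h0, h1⟩
  exact ⟨β, ⟨hβ.1, hβ.2, hβ0⟩, fun b hb _ hb0 =>
    hmono.injOn hb.le hβ.1.le (hb0.trans hβ0.symm)⟩

theorem width_le_one (A : Matrix (Fin m) (Fin n) ℝ) (k : ℕ) : width A k ≤ 1 := by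
  have h3 := ric_nonneg A (3 * k)
  have h1 := ric_nonneg A k
  have h2' := ric_nonneg A (2 * k)
  have hφ := Real.one_lt_goldenRatio
  have hs : √((1 - ric A (2 * k)) / (1 + ric A k)) ≤ 1 := by
    rw [Real.sqrt_le_one, div_le_one (by linarith)]
    linarith
  have hf : 1 / (3 * Real.goldenRatio) ≤ 1 := by
    rw [div_le_one (by positivity)]; linarith
  have hp : 0 ≤ √(blocks n k) * ric A (3 * k) := by positivity
  rw [width, div_le_one (by linarith)]
  have := mul_le_one₀ hf (Real.sqrt_nonneg _) hs
  linarith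

/-- Each bound on `λ` handles one quotient directly. The other two inequalities use `c ≤ 1` and `δ <
c`, the latter being equivalent to the range for `λ` being nonempty. -/
theorem Delta_lt {lam δ c : ℝ} (h0 : 0 ≤ δ) (h1 : δ < 1) (hc : c ≤ 1)
    (hl : (1 + δ) * (1 - c) < lam) (hu : lam < (1 - δ) * (1 + c)) : Delta lam δ < c := by
  have hp : 0 < 1 + δ := by linarith
  have hm : 0 < 1 - δ := by linarith
  have hδc : δ < c := by nlinarith
  have a1 : lam / (1 - δ) < 1 + c := by rw [div_lt_iff₀ hm]; linarith
  have a2 : 1 - c < lam / (1 - δ) := by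
    rw [lt_div_iff₀ hm]; nlinarith
  have a3 : lam / (1 + δ) < 1 + c := by
    rw [div_lt_iff₀ hp]; nlinarith
  have a4 : 1 - c < lam / (1 + δ) := by rw [lt_div_iff₀ hp]; linarith
  exact max_lt (abs_lt.2 ⟨by linarith, by linarith⟩) (abs_lt.2 ⟨by linarith, by linarith⟩)

theorem rho_nonneg (A : Matrix (Fin m) (Fin n) ℝ) (k q : ℕ) (lam : ℝ) : 0 ≤ rho A k q lam := by
  have := ric_nonneg A (3 * k)
  have := Real.goldenRatio_pos
  have : 0 ≤ Delta lam (ric A q) := le_max_of_le_left (abs_nonneg _)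
  unfold rho
  positivity

/-- Clearing denominators in `Δ < c` gives the claim, as the two square roots are reciprocal. -/
theorem rho_lt_one {k q : ℕ} {lam : ℝ} (h2 : ric A (2 * k) < 1)
    (h : Delta lam (ric A q) < width A k) : rho A k q lam < 1 := by
  have h3 := ric_nonneg A (3 * k)
  have h1 := ric_nonneg A k
  have hφ := Real.goldenRatio_pos
  have hm : 0 < 1 - ric A (2 * k) := by linarith
  have hp : 0 < 1 + ric A k := by linarith
  have hpos : 0 < 1 + √(blocks n k) * ric A (3 * k) := by positivity
  rw [width, lt_div_iff₀ hpos] at h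
  have hs : √((1 + ric A k) / (1 - ric A (2 * k))) * √((1 - ric A (2 * k)) / (1 + ric A k)) = 1 := by
    rw [← Real.sqrt_mul (by positivity), div_mul_div_comm, mul_comm (1 + ric A k),
      div_self (by positivity), Real.sqrt_one]
  have hpp : 0 < √((1 + ric A k) / (1 - ric A (2 * k))) := by positivity
  calc rho A k q lam < 3 * Real.goldenRatio * √((1 + ric A k) / (1 - ric A (2 * k))) *
        (1 / (3 * Real.goldenRatio) * √((1 - ric A (2 * k)) / (1 + ric A k))) := by
        unfold rho
        refine mul_lt_mul_of_pos_left ?_ (by positivity)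
        linarith
    _ = √((1 + ric A k) / (1 - ric A (2 * k))) * √((1 - ric A (2 * k)) / (1 + ric A k)) := by
        field_simp
    _ = 1 := hs

end Constants

/-! ### Assembly: error recursion and convergence. -/

theorem IsSequence.exists_support {m n : ℕ} {A : Matrix (Fin m) (Fin n) ℝ}
    {y : EuclideanSpace ℝ (Fin m)} {k q : ℕ} {lam α γ : ℝ} {X : ℕ → EuclideanSpace ℝ (Fin n)}
    (hX : IsSequence A y k q lam α γ X) (p : ℕ) :
    ∃ T : Finset (Fin n), T.card ≤ k ∧ restrict T (X p) = X p := by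
  cases p with
  | zero => exact ⟨∅, by simp, by rw [hX.1]; ext i; simp⟩
  | succ p =>
    obtain ⟨Ω, w, -, -, T, hT, -, h⟩ := hX.2 p
    exact ⟨T, hT.le.trans (min_le_left _ _), by rw [h, restrict_restrict]⟩

theorem norm_step_sub_le {m n k q : ℕ} (hk : 1 ≤ k) {A : Matrix (Fin m) (Fin n) ℝ}
    {y η : EuclideanSpace ℝ (Fin m)} {x x' x'' : EuclideanSpace ℝ (Fin n)} {lam α γ : ℝ}
    {S T : Finset (Fin n)} (hS : S.card ≤ k) (hxS : restrict S x = x)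
    (hT : T.card ≤ k) (hxT : restrict T x' = x') (hy : y = apply A x + η)
    (h2k : ric A (2 * k) < 1) (hq : ric A q < 1) (hlam : 0 ≤ lam)
    (h1 : 1 / (1 + ric A q) ≤ α * γ) (h2 : α * γ ≤ 1 / (1 - ric A q))
    (hstep : IsStep A y k q lam α γ x' x'') :
    ‖x'' - x‖ ≤ rho A k q lam * ‖x' - x‖ + tau A k q lam * ‖η‖ := by
  obtain ⟨Ω, w, hΩ, hw, hx''⟩ := hstep
  have hU : (S ∪ T).card ≤ 2 * k := by
    have := Finset.card_union_le S T
    omega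
  have hxU : restrict (S ∪ T) (x - x') = x - x' := by
    rw [restrict_sub, restrict_eq_self_of_subset Finset.subset_union_left hxS,
      restrict_eq_self_of_subset Finset.subset_union_right hxT]
  have hmain := norm_optimalThreshold_sub_le hS hxS hy h2k
    (fun K hK => norm_restrict_newtonStep_sub_le hk hy hU hxU hΩ.1 hq hlam h1 h2 hK) hw hx''
  refine hmain.trans ?_
  have d3 := ric_nonneg A (3 * k)
  have d1 := ric_nonneg A k
  have hφ := Real.goldenRatio_pos
  have hm : 0 < 1 - ric A (2 * k) := by linarith
  have hmq : 0 < 1 - ric A q := by linarith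
  have hp : 0 < 1 + ric A k := by linarith
  have hΔ : 0 ≤ Delta lam (ric A q) := le_max_of_le_left (abs_nonneg _)
  have hsm : 0 < √(1 - ric A (2 * k)) := Real.sqrt_pos.2 hm
  set r := ric A (3 * k) + Delta lam (ric A q) * (1 + √(blocks n k) * ric A (3 * k)) with hr
  have hr0 : 0 ≤ r := by positivity
  set c := lam * √(blocks n k) * √(1 + ric A k) / (1 - ric A q) with hc
  have hc0 : 0 ≤ c := by positivity
  have hrho : rho A k q lam =
      Real.goldenRatio / √(1 - ric A (2 * k)) * (3 * (√(1 + ric A k) * r)) := by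
    rw [rho, ← hr, Real.sqrt_div hp.le]; ring
  have htau : tau A k q lam =
      Real.goldenRatio / √(1 - ric A (2 * k)) * (3 * (√(1 + ric A k) * c) + 2) := by
    have := Real.mul_self_sqrt hp.le
    rw [tau, hc]
    nth_rewrite 1 [← this]
    field_simp
  -- The thresholding estimate yields the constant `2` where `ρ₃` and the first term of `τ₃` carry
  -- `3`; nonnegativity absorbs the difference.
  have n1 : 0 ≤ √(1 + ric A k) * r * ‖x' - x‖ := by positivity
  have n2 : 0 ≤ √(1 + ric A k) * c * ‖η‖ := by positivity
  have hg : 0 ≤ Real.goldenRatio / √(1 - ric A (2 * k)) := by positivity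
  rw [hrho, htau]
  calc _ ≤ Real.goldenRatio / √(1 - ric A (2 * k)) *
        (3 * (√(1 + ric A k) * r) * ‖x' - x‖ + (3 * (√(1 + ric A k) * c) + 2) * ‖η‖) :=
        mul_le_mul_of_nonneg_left (by linarith) hg
    _ = _ := by ring

theorem tendsto_of_linear_contraction {E : Type*} [NormedAddCommGroup E] {X : ℕ → E} {x : E}
    {r : ℝ} (hr : 0 ≤ r) (hr1 : r < 1) (h : ∀ p, ‖X (p + 1) - x‖ ≤ r * ‖X p - x‖) :
    Tendsto X atTop (𝓝 x) := by
  have hb : ∀ p, ‖X p - x‖ ≤ r ^ p * ‖X 0 - x‖ := by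
    intro p
    induction p with
    | zero => simp
    | succ p ih =>
      calc _ ≤ r * ‖X p - x‖ := h p
        _ ≤ r * (r ^ p * ‖X 0 - x‖) := mul_le_mul_of_nonneg_left ih hr
        _ = _ := by ring
  rw [tendsto_iff_norm_sub_tendsto_zero]
  refine squeeze_zero (fun _ => norm_nonneg _) hb ?_
  simpa using (tendsto_pow_atTop_nhds_zero_of_lt_one hr hr1).mul_const ‖X 0 - x‖

end CNOT

theorem mainTheorem3 (m n k q : ℕ) (hk : 1 ≤ k) (hq : k ≤ q) :
    ∃ β : ℝ, (0 < β ∧ β < 1 ∧ CNOT.quintic n k β = 0) ∧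
      (∀ b : ℝ, 0 < b → b < 1 → CNOT.quintic n k b = 0 → b = β) ∧
      ∀ (A : Matrix (Fin m) (Fin n) ℝ) (x : EuclideanSpace ℝ (Fin n))
        (y η η' : EuclideanSpace ℝ (Fin m)) (S : Finset (Fin n)) (lam α γ : ℝ),
        y = CNOT.apply A x + η →
        CNOT.IsTopIndexSet k x S →
        η' = CNOT.apply A (CNOT.restrict Sᶜ x) + η →
        CNOT.ric A (max q (3 * k)) < β →
        (1 + CNOT.ric A q) * (1 - CNOT.width A k) < lam →
        lam < (1 - CNOT.ric A q) * (1 + CNOT.width A k) →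
        0 < α → 0 < γ →
        1 / (1 + CNOT.ric A q) ≤ α * γ → α * γ ≤ 1 / (1 - CNOT.ric A q) →
        CNOT.rho A k q lam < 1 ∧
        ∀ X : ℕ → EuclideanSpace ℝ (Fin n), CNOT.IsSequence A y k q lam α γ X →
          (∀ p : ℕ, ‖X (p + 1) - CNOT.restrict S x‖
            ≤ CNOT.rho A k q lam * ‖X p - CNOT.restrict S x‖ + CNOT.tau A k q lam * ‖η'‖) ∧
          (η' = 0 → Tendsto X atTop (𝓝 (CNOT.restrict S x))) := by
  obtain ⟨β, hβ, huniq⟩ := CNOT.exists_unique_quintic_root n k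
  refine ⟨β, hβ, huniq, ?_⟩
  intro A x y η η' S lam α γ hy hS hη' hric hl hu _ _ h1 h2
  have hmax : CNOT.ric A (max q (3 * k)) < 1 := hric.trans hβ.2.1
  have hq1 : CNOT.ric A q < 1 := (CNOT.ric_mono A (le_max_left _ _)).trans_lt hmax
  have h2k : CNOT.ric A (2 * k) < 1 :=
    (CNOT.ric_mono A ((by omega : 2 * k ≤ 3 * k).trans (le_max_right _ _))).trans_lt hmax
  have hq0 := CNOT.ric_nonneg A q
  have hw := CNOT.width_le_one A k
  -- The lower end of the stepsize range is nonnegative because `c ≤ 1`.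
  have hlam : 0 ≤ lam := (mul_nonneg (by linarith) (by linarith)).trans hl.le
  have hrho := CNOT.rho_lt_one h2k (CNOT.Delta_lt hq0 hq1 hw hl hu)
  have hy' : y = CNOT.apply A (CNOT.restrict S x) + η' := by
    rw [hη', ← add_assoc, ← map_add, CNOT.restrict_add_restrict_compl, hy]
  refine ⟨hrho, fun X hX => ?_⟩
  have hstep : ∀ p : ℕ, ‖X (p + 1) - CNOT.restrict S x‖
      ≤ CNOT.rho A k q lam * ‖X p - CNOT.restrict S x‖ + CNOT.tau A k q lam * ‖η'‖ := by
    intro p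
    obtain ⟨T, hT, hTX⟩ := hX.exists_support p
    exact CNOT.norm_step_sub_le hk hS.1 (CNOT.restrict_restrict S x) hT hTX hy' h2k hq1 hlam h1 h2
      (hX.2 p)
  refine ⟨hstep, fun h0 => ?_⟩
  exact CNOT.tendsto_of_linear_contraction (CNOT.rho_nonneg A k q lam) hrho
    fun p => by simpa [h0] using hstep p
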